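/- Let $\Omega\subset\mathbb R^2$ be a bounded domain (non-empty connected open set) with smooth boundary, let $|\Omega|$ be its area, and let $n=n(\Omega)\ge 1$ be its number of holes, i.e. the number of bounded connected components of $\mathbb R^2\setminus\Omega$. Let $A$ be a closed real $1$-form on $\Omega$, smooth up to the boundary, and let $$\lambda_1(\Omega,A)=\inf\Big\{\frac{\int_\Omega|\nabla u-iuA^\sharp|^2}{\int_\Omega|u|^2}:\ u\in H^1(\Omega,\mathbb C)\setminus\{0\}\Big\}$$ be the lowest eigenvalue of the magnetic Neumann Laplacian with potential $A$, where $A^\sharp$ is the vector field dual to $A$. An admissible cut of $\Omega$ is a family $\Gamma=\{\Gamma_1,\dots,\Gamma_n\}$ of $n$ segments contained in $\overline\Omega$ (possibly reduced to points) such that $\Omega\setminus(\Gamma_1\cup\dots\cup\Gamma_n)$ is simply connected, and $h(\Omega)$ is the minimum of the total length $\sum_{j=1}^n \mathrm{length}(\Gamma_j)$ over all admissible cuts. Let $\Gamma$ be an admissible cut that attains this minimum, and let $h_j=\mathrm{length}(\Gamma_j)$, so that $h(\Omega)=\sum_{j=1}^n h_j$. If $h(\Omega)\le\frac{|\Omega|}{2\pi}$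 and $h_j\le e^{-2}$ for every $j=1,\dots,n$, then $$\lambda_1(\Omega,A)\le\frac{8\pi\, n(\Omega)^2}{|\Omega|}\cdot\frac{1}{\Big|\ln\frac{h(\Omega)}{n(\Omega)}\Big|}.$$ -/

import Mathlib

open MeasureTheory Set
open scoped ContDiff

noncomputable section

/-- The Euclidean plane. -/
abbrev Plane : Type := EuclideanSpace ℝ (Fin 2)

/-- The standard basis vectors of the plane. -/
def stdVec (j : Fin 2) : Plane := EuclideanSpace.single j (1 : ℝ)

/-- A bounded domain of the plane (open, connected, non-empty, bounded) with smooth boundary: near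
each boundary point it is the sublevel set of a smooth function with non-vanishing differential. -/
structure IsSmoothBoundedDomain (Ω : Set Plane) : Prop where
  isOpen : IsOpen Ω
  isConnected : IsConnected Ω
  isBounded : Bornology.IsBounded Ω
  smooth_boundary : ∀ p ∈ frontier Ω, ∃ U : Set Plane, IsOpen U ∧ p ∈ U ∧
    ∃ ρ : Plane → ℝ, ContDiff ℝ ∞ ρ ∧ ρ p = 0 ∧ fderiv ℝ ρ p ≠ 0 ∧
      Ω ∩ U = {x | ρ x < 0} ∩ U

/-- The holes of `Ω`: the bounded connected components of the complement of `Ω`. -/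
def holes (Ω : Set Plane) : Set (Set Plane) :=
  {C | Bornology.IsBounded C ∧ ∃ x ∈ Ωᶜ, C = connectedComponentIn Ωᶜ x}

/-- The number `n(Ω)` of holes of `Ω`. -/
def numHoles (Ω : Set Plane) : ℕ := (holes Ω).ncard

/-- A closed one-form on `Ω`, smooth up to the boundary: its differential
`dA (v, w) = D_v A (w) - D_w A (v)` vanishes in `Ω`. -/
structure IsClosedPotential (Ω : Set Plane) (A : Plane → (Plane →L[ℝ] ℝ)) : Prop where
  smooth : ContDiffOn ℝ ∞ A (closure Ω)
  closed : ∀ x ∈ Ω, ∀ v w : Plane, fderiv ℝ A x v w = fderiv ℝ A x w v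

/-- `u` belongs to the complex Sobolev space `H¹(Ω)`, with weak partial derivatives `g 0`, `g 1`. -/
structure HasH1Gradient (Ω : Set Plane) (u : Plane → ℂ) (g : Fin 2 → Plane → ℂ) : Prop where
  memLp : MemLp u 2 (volume.restrict Ω)
  memLp_grad : ∀ j, MemLp (g j) 2 (volume.restrict Ω)
  weak_grad : ∀ j, ∀ φ : Plane → ℝ, ContDiff ℝ ∞ φ → HasCompactSupport φ → tsupport φ ⊆ Ω →
    ∫ x in Ω, ((fderiv ℝ φ x (stdVec j) : ℝ) : ℂ) * u x = - ∫ x in Ω, ((φ x : ℝ) : ℂ) * g j x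

/-- The magnetic energy `∫_Ω |∇u - i u A|²` of a function `u` with weak gradient `g`. -/
def magneticEnergy (Ω : Set Plane) (A : Plane → (Plane →L[ℝ] ℝ))
    (u : Plane → ℂ) (g : Fin 2 → Plane → ℂ) : ℝ :=
  ∫ x in Ω, ∑ j, ‖g j x - Complex.I * u x * ((A x (stdVec j) : ℝ) : ℂ)‖ ^ 2

/-- The ground state energy `λ₁(Ω, A)` of the magnetic Neumann Laplacian: the least value of the
Rayleigh quotient on `H¹(Ω) \ {0}`. -/
def groundEnergy (Ω : Set Plane) (A : Plane → (Plane →L[ℝ] ℝ)) : ℝ :=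
  sInf {R | ∃ (u : Plane → ℂ) (g : Fin 2 → Plane → ℂ), HasH1Gradient Ω u g ∧
    ¬ (u =ᵐ[volume.restrict Ω] 0) ∧
    R = magneticEnergy Ω A u g / ∫ x in Ω, ‖u x‖ ^ 2}

/-- An admissible cut of `Ω`: a family of `n(Ω)` segments of `Ω` (the end points of a segment may
lie on the boundary, and a segment may reduce to a point) whose removal makes `Ω` simply
connected. The `j`-th segment is given by its pair of end points. -/
structure IsAdmissibleCut (Ω : Set Plane) (Γ : Fin (numHoles Ω) → Plane × Plane) : Prop where
  segment_subset : ∀ j, segment ℝ (Γ j).1 (Γ j).2 ⊆ closure Ω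
  isSimplyConnected : IsSimplyConnected (Ω \ ⋃ j, segment ℝ (Γ j).1 (Γ j).2)

/-- The length `h_j` of the `j`-th segment of a family. -/
def cutLength {n : ℕ} (Γ : Fin n → Plane × Plane) (j : Fin n) : ℝ := dist (Γ j).1 (Γ j).2

/-- The constant `h(Ω)`: the least total length of an admissible cut of `Ω`. -/
def cutConst (Ω : Set Plane) : ℝ :=
  sInf {ℓ | ∃ Γ : Fin (numHoles Ω) → Plane × Plane, IsAdmissibleCut Ω Γ ∧ ℓ = ∑ j, cutLength Γ j}

end

/-! Removing the cut makes `Ω` simply connected, so the closed form is exact there, `A = dθ`, and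
the gauge factor `e^{iθ}` removes the potential: for a real cutoff `φ` vanishing near the cut, `u =
φ e^{iθ}` satisfies `|∇u - iuA| = |∇φ|`. Hence `λ₁` is at most `∫|∇φ|²` divided by the area of the
part of `Ω` where `φ = 1`, and it remains to find a cheap cutoff.

For a segment of length `h`, the curve at distance `r` has length `2πr + 2h = 2π(r + h/π)`. In the
shifted distance `ρ = r + h/π` it is therefore as long as a circle of radius `ρ`
(`lintegral_infDist_segment`). The logarithmic cutoff in `ρ` between radii `s < t` then costs at
most `2π / log(t/s)` and the set `ρ < t` has area at most `πt²`. It vanishes near the segment as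
soon as `s > h/π`. For several segments the minimum of the cutoffs is used; its energy is at most
the sum of the energies (`lintegral_fderiv_finMin_le`).

With `s = η/π`, `t = √η/π` and `η` slightly above `h_j`, each cutoff costs `4π/|log η|`, and the
area hypothesis keeps at least half of `Ω`. Letting the excess tend to `0` gives `8πn/|Ω| · 1/|log
H|` with `H = max h_j` (`groundEnergy_le_of_cut`). Comparing `H` with the mean `h/n` costs another
factor `n` (`neg_inv_log_le`). -/

noncomputable section

/-! ### Primitives of closed one-forms on simply connected sets -/

/-- The real numbers with the discrete topology: the fibre of the bundle of germs of primitives. -/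
def DiscreteReal : Type := ℝ

instance : AddCommGroup DiscreteReal := inferInstanceAs (AddCommGroup ℝ)
instance : TopologicalSpace DiscreteReal := ⊥
instance : DiscreteTopology DiscreteReal := ⟨rfl⟩

/-- The bundle of germs of primitives of a closed one-form with local primitives `f i`. -/
def primitiveBundle {ι B : Type*} [TopologicalSpace B] (S : ι → Set B) (hS : ∀ i, IsOpen (S i))
    (idx : B → ι) (hidx : ∀ x, x ∈ S (idx x)) (f : ι → B → DiscreteReal)
    (hf : ∀ i j, ∀ x ∈ S i ∩ S j, ∀ y ∈ S i ∩ S j, f i x - f j x = f i y - f j y) :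
    FiberBundleCore ι B DiscreteReal where
  baseSet := S
  isOpen_baseSet := hS
  indexAt := idx
  mem_baseSet_at := hidx
  coordChange i j x v := v + (f i x - f j x)
  coordChange_self i x _ v := by simp
  continuousOn_coordChange i j := by
    rcases (S i ∩ S j).eq_empty_or_nonempty with h | ⟨y, hy⟩
    · rw [h, empty_prod]; exact continuousOn_empty _
    · have hc : Continuous fun p : B × DiscreteReal => p.2 + (f i y - f j y) :=
        (continuous_of_discreteTopology (f := fun v : DiscreteReal => v + (f i y - f j y))).comp
          continuous_snd
      refine hc.continuousOn.congr ?_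
      rintro ⟨x, v⟩ ⟨hx, -⟩
      simp only [hf i j x hx y hy]
  coordChange_comp i j k x _ v := by abel

/-- The local primitives differ by constants on overlaps, so their germs form a bundle with discrete
fibre, that is, a covering of `B`. Simple connectivity lifts the identity to a global section, and a
section is a coherent choice of the additive constants. -/
theorem exists_glued_primitive {ι B : Type*} [TopologicalSpace B] [SimplyConnectedSpace B]
    [LocallyPathConnectedSpace B] (S : ι → Set B) (hS : ∀ i, IsOpen (S i))
    (idx : B → ι) (hidx : ∀ x, x ∈ S (idx x)) (f : ι → B → ℝ)
    (hf : ∀ i j, ∀ x ∈ S i ∩ S j, ∀ y ∈ S i ∩ S j, f i x - f j x = f i y - f j y) :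
    ∃ θ : B → ℝ, ∀ x i, x ∈ S i → ∃ c : ℝ, ∀ᶠ y in nhds x, θ y = f i y + c := by
  let Z := primitiveBundle S hS idx hidx (fun i x => (f i x : ℝ)) hf
  have cov : IsCoveringMap Z.proj := FiberBundle.isCoveringMap (F := DiscreteReal) (E := Z.Fiber)
  obtain ⟨x₀⟩ : Nonempty B := inferInstance
  obtain ⟨σ, ⟨-, hσ⟩, -⟩ := cov.existsUnique_continuousMap_lifts (ContinuousMap.id B) x₀
    (⟨x₀, (0 : DiscreteReal)⟩ : Z.TotalSpace) rfl
  have hσ1 : ∀ x, (σ x).1 = x := fun x => congrFun hσ x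
  let s : B → ℝ := fun x => (σ x).2
  refine ⟨fun x => f (idx x) x + s x, fun x i hx => ?_⟩
  have hloc : ∀ y, (Z.localTriv i (σ y)).2 = ((s y + (f (idx y) y - f i y) : ℝ) : DiscreteReal) := by
    intro y
    rw [Z.localTriv_apply]
    change s y + (f (idx (σ y).1) (σ y).1 - f i (σ y).1) = _
    rw [hσ1]
  have hcont : ContinuousAt (fun y => (Z.localTriv i (σ y)).2) x := by
    have hmem : σ x ∈ (Z.localTriv i).source := by
      rw [Z.mem_localTriv_source, ← Z.baseSet_at, hσ1]; exact hx
    exact continuous_snd.continuousAt.comp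
      (((Z.localTriv i).continuousAt hmem).comp σ.continuous.continuousAt)
  -- A continuous map into a discrete space is locally constant.
  have hev : ∀ᶠ y in nhds x, (Z.localTriv i (σ y)).2 = (Z.localTriv i (σ x)).2 :=
    hcont.eventually (show {(Z.localTriv i (σ x)).2} ∈ nhds _ from by simp)
  refine ⟨s x + (f (idx x) x - f i x), hev.mono fun y hy => ?_⟩
  rw [hloc, hloc] at hy
  have hy' : s y + (f (idx y) y - f i y) = s x + (f (idx x) x - f i x) := hy
  change f (idx y) y + s y = f i y + (s x + (f (idx x) x - f i x))
  rw [← hy']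
  ring

/-- Poincaré's lemma: a closed one-form on a simply connected open set is exact. -/
theorem IsSimplyConnected.exists_hasFDerivAt {E : Type*} [NormedAddCommGroup E] [NormedSpace ℝ E]
    {U : Set E} (hU : IsSimplyConnected U) (hUo : IsOpen U) {A : E → (E →L[ℝ] ℝ)}
    (hA : DifferentiableOn ℝ A U)
    (hcl : ∀ x ∈ U, ∀ v w : E, fderiv ℝ A x v w = fderiv ℝ A x w v) :
    ∃ θ : E → ℝ, ∀ x ∈ U, HasFDerivAt θ (A x) x := by
  classical
  have := hU.simplyConnectedSpace
  have := hUo.locallyPathConnectedSpace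
  have hr : ∀ x : U, ∃ r > 0, Metric.ball (x : E) r ⊆ U := fun x =>
    Metric.isOpen_iff.1 hUo x x.2
  choose r hr0 hrU using hr
  have hp : ∀ x : U, ∃ f : E → ℝ, ∀ a ∈ Metric.ball (x : E) (r x), HasFDerivAt f (A a) a :=
    fun x => (convex_ball _ _).exists_forall_hasFDerivAt_of_fderiv_symmetric Metric.isOpen_ball
      (hA.mono (hrU x)) fun a ha => hcl a (hrU x ha)
  choose f hf using hp
  obtain ⟨θ, hθ⟩ := exists_glued_primitive (B := U)
    (fun x : U => (Subtype.val : U → E) ⁻¹' Metric.ball (x : E) (r x))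
    (fun x => Metric.isOpen_ball.preimage continuous_subtype_val) id
    (fun x => Metric.mem_ball_self (hr0 x)) (fun i x => f i x) (by
      rintro i j x hx y hy
      -- Overlaps of balls are convex, hence connected, so two primitives differ there by a single
      -- constant.
      have hconv : Convex ℝ (Metric.ball (i : E) (r i) ∩ Metric.ball (j : E) (r j)) :=
        (convex_ball _ _).inter (convex_ball _ _)
      have hd : ∀ a ∈ Metric.ball (i : E) (r i) ∩ Metric.ball (j : E) (r j),
          HasFDerivAt (fun z => f i z - f j z) (0 : E →L[ℝ] ℝ) a := fun a ha => by
        simpa using (hf i a ha.1).fun_sub (hf j a ha.2)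
      exact (Metric.isOpen_ball.inter Metric.isOpen_ball).is_const_of_fderiv_eq_zero
        hconv.isPreconnected (fun a ha => (hd a ha).differentiableAt.differentiableWithinAt)
        (fun a ha => (hd a ha).fderiv) hx hy)
  refine ⟨fun x => if hx : x ∈ U then θ ⟨x, hx⟩ else 0, fun x hx => ?_⟩
  obtain ⟨c, hc⟩ := hθ ⟨x, hx⟩ ⟨x, hx⟩ (Metric.mem_ball_self (hr0 _))
  have h1 : HasFDerivAt (fun y => f ⟨x, hx⟩ y + c) (A x) x :=
    (hf ⟨x, hx⟩ x (Metric.mem_ball_self (hr0 _))).add_const c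
  refine h1.congr_of_eventuallyEq ?_
  rw [nhds_subtype_eq_comap, Filter.eventually_comap] at hc
  filter_upwards [hc, hUo.mem_nhds hx] with y hy hyU
  simpa [hyU] using hy ⟨y, hyU⟩ rfl

/-! ### Integration of functions of the distance from a segment -/

/-- The distance of `(s, t)` from the segment `[0, h] × {0}`. -/
def axisDist (h : ℝ) (z : ℝ × ℝ) : ℝ := √((z.1 - max 0 (min z.1 h)) ^ 2 + z.2 ^ 2)

theorem continuous_axisDist (h : ℝ) : Continuous (axisDist h) := by
  unfold axisDist; fun_prop

theorem axisDist_le {h s t a : ℝ} (ha : 0 ≤ a) (hah : a ≤ h) :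
    axisDist h (s, t) ≤ √((s - a) ^ 2 + t ^ 2) := by
  refine Real.sqrt_le_sqrt (add_le_add_left (sq_le_sq.2 ?_) _)
  dsimp only
  rcases le_total s h with h1 | h1
  · rw [min_eq_left h1]
    rcases le_total s 0 with h2 | h2
    · rw [max_eq_left h2, abs_of_nonpos (by linarith), abs_of_nonpos (by linarith)]; linarith
    · rw [max_eq_right h2]; simp
  · rw [min_eq_right h1, max_eq_right (by linarith), abs_of_nonneg (by linarith),
      abs_of_nonneg (by linarith)]; linarith

/-- In suitable Cartesian coordinates a segment lies on the first coordinate axis. -/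
theorem exists_coordinates_infDist_segment (p q : Plane) :
    ∃ T : Plane → ℝ × ℝ, MeasurePreserving T ∧
      ∀ x, Metric.infDist x (segment ℝ p q) = axisDist (dist p q) (T x) := by
  obtain ⟨e, he, heq⟩ : ∃ e : Plane, ‖e‖ = 1 ∧ q - p = dist p q • e := by
    rcases eq_or_ne p q with rfl | hne
    · exact ⟨stdVec 0, by simp [stdVec], by simp⟩
    · have h0 : ‖q - p‖ ≠ 0 := by simpa [sub_eq_zero] using hne.symm
      refine ⟨(dist p q)⁻¹ • (q - p), ?_, ?_⟩
      · rw [dist_comm, dist_eq_norm, norm_smul, norm_inv, norm_norm, inv_mul_cancel₀ h0]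
      · rw [smul_smul, dist_comm, dist_eq_norm, mul_inv_cancel₀ h0, one_smul]
  obtain ⟨b, hb⟩ := Orthonormal.exists_orthonormalBasis_extension_of_card_eq (𝕜 := ℝ) (E := Plane)
    (ι := Fin 2) (by simp) (v := fun _ => e) (s := {0}) (by
      constructor
      · intro i; simpa using he
      · intro i j hij; exact absurd (Subsingleton.elim i j) hij)
  have hb0 : b 0 = e := hb 0 rfl
  let T : Plane → ℝ × ℝ := fun x => (b.repr (x - p) 0, b.repr (x - p) 1)
  refine ⟨T, ?_, fun x => ?_⟩
  · exact (volume_preserving_finTwoArrow ℝ).comp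
      ((PiLp.volume_preserving_ofLp (Fin 2)).comp
        (b.measurePreserving_repr.comp (measurePreserving_sub_right volume p)))
  · have hdist : ∀ τ : ℝ, dist x (p + τ • (q - p)) =
        √(((T x).1 - τ * dist p q) ^ 2 + (T x).2 ^ 2) := by
      intro τ
      rw [dist_eq_norm, ← b.repr.norm_map, EuclideanSpace.norm_eq, Fin.sum_univ_two, heq,
        show x - (p + τ • dist p q • e) = (x - p) - (τ * dist p q) • e by
          rw [smul_smul]; abel, ← hb0, map_sub, map_smul, b.repr_self]
      simp [T]
    have hh : 0 ≤ dist p q := dist_nonneg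
    refine le_antisymm ?_ ((Metric.le_infDist ⟨p, left_mem_segment ℝ p q⟩).2 ?_)
    · obtain ⟨τ, hτ0, hτ1, hτ⟩ : ∃ τ : ℝ, 0 ≤ τ ∧ τ ≤ 1 ∧
          τ * dist p q = max 0 (min (T x).1 (dist p q)) := by
        rcases hh.eq_or_lt with h0 | h0
        · exact ⟨0, le_rfl, zero_le_one, by rw [← h0]; simp⟩
        · refine ⟨max 0 (min (T x).1 (dist p q)) / dist p q, by positivity, ?_,
            div_mul_cancel₀ _ h0.ne'⟩
          rw [div_le_one h0]
          exact max_le hh (min_le_right _ _)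
      have := Metric.infDist_le_dist_of_mem (x := x)
        (show p + τ • (q - p) ∈ segment ℝ p q by
          rw [segment_eq_image']; exact ⟨τ, ⟨hτ0, hτ1⟩, rfl⟩)
      rwa [hdist, hτ] at this
    · intro y hy
      rw [segment_eq_image'] at hy
      obtain ⟨τ, ⟨h0, h1⟩, rfl⟩ := hy
      rw [hdist]
      exact axisDist_le (by positivity) (mul_le_of_le_one_left hh h1)

theorem lintegral_comp_abs {F : ℝ → ENNReal} :
    ∫⁻ t : ℝ, F |t| = 2 * ∫⁻ r in Ioi 0, F r := by
  have h1 : ∫⁻ t in Ioi (0 : ℝ), F |t| = ∫⁻ r in Ioi 0, F r :=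
    setLIntegral_congr_fun measurableSet_Ioi fun t ht => by rw [abs_of_pos ht]
  have h2 : ∫⁻ t in (Ioi (0 : ℝ))ᶜ, F |t| = ∫⁻ r in Ioi 0, F r := by
    rw [compl_Ioi, ← setLIntegral_congr (Iio_ae_eq_Iic (a := (0 : ℝ)) (μ := volume)), ← h1]
    have := (Measure.measurePreserving_neg (volume : Measure ℝ)).setLIntegral_comp_preimage_emb
      (MeasurableEquiv.neg ℝ).measurableEmbedding (fun t => F |t|) (Ioi 0)
    simpa using this
  rw [← lintegral_add_compl _ measurableSet_Ioi, h1, h2, two_mul]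

theorem lintegral_radial {F : ℝ → ENNReal} (hF : Measurable F) :
    ∫⁻ z : ℝ × ℝ, F √(z.1 ^ 2 + z.2 ^ 2) =
      ∫⁻ r in Ioi 0, F r * ENNReal.ofReal (2 * Real.pi * r) := by
  rw [← lintegral_comp_polarCoord_symm, polarCoord_target, Measure.volume_eq_prod]
  have : ∀ z ∈ Ioi (0 : ℝ) ×ˢ Ioo (-Real.pi) Real.pi,
      ENNReal.ofReal z.1 • F √((polarCoord.symm z).1 ^ 2 + (polarCoord.symm z).2 ^ 2) =
        ENNReal.ofReal z.1 * F z.1 := by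
    rintro ⟨r, φ⟩ ⟨hr, -⟩
    have hr' : (0 : ℝ) < r := hr
    simp only [polarCoord_symm_apply, smul_eq_mul]
    rw [show (r * Real.cos φ) ^ 2 + (r * Real.sin φ) ^ 2 = r ^ 2 by
      linear_combination r ^ 2 * Real.cos_sq_add_sin_sq φ, Real.sqrt_sq hr'.le]
  rw [setLIntegral_congr_fun (measurableSet_Ioi.prod measurableSet_Ioo) this,
    setLIntegral_prod _ (by fun_prop)]
  refine setLIntegral_congr_fun measurableSet_Ioi fun r hr => ?_
  have hr' : (0 : ℝ) < r := hr
  simp only [lintegral_const, Measure.restrict_apply_univ, Real.volume_Ioo]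
  rw [mul_comm (ENNReal.ofReal r), mul_assoc, ← ENNReal.ofReal_mul hr'.le]
  congr 2; ring

/-- The lines `z.1 = 0` and `z.1 = h` split the plane. The two outer half-planes, slid together,
form a plane in which the distance is radial and contribute `2πr`; the strip of width `h` between
them contributes `2h`, one `h` for each side. -/
theorem lintegral_axisDist {F : ℝ → ENNReal} (hF : Measurable F) {h : ℝ} (hh : 0 ≤ h) :
    ∫⁻ z, F (axisDist h z) = ∫⁻ r in Ioi 0, F r * ENNReal.ofReal (2 * Real.pi * r + 2 * h) := by
  let G : ℝ × ℝ → ENNReal := fun z => F √(z.1 ^ 2 + z.2 ^ 2)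
  let L : Set (ℝ × ℝ) := {z | z.1 ≤ 0}
  have hL : MeasurableSet L := measurableSet_le measurable_fst measurable_const
  let M : Set (ℝ × ℝ) := Ioc 0 h ×ˢ univ
  have hM : MeasurableSet M := measurableSet_Ioc.prod .univ
  have hR : MeasurableSet {z : ℝ × ℝ | h < z.1} := measurableSet_lt measurable_const measurable_fst
  have e1 : ∫⁻ z in L, F (axisDist h z) = ∫⁻ z in L, G z := by
    refine setLIntegral_congr_fun hL fun z (hz : z.1 ≤ 0) => ?_
    simp only [axisDist, G]
    rw [min_eq_left (by linarith), max_eq_left hz, sub_zero]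
  have e2 : ∫⁻ z in M, F (axisDist h z) = ∫⁻ r in Ioi 0, F r * ENNReal.ofReal (2 * h) := by
    have : ∀ z ∈ M, F (axisDist h z) = F |z.2| := by
      rintro ⟨s, t⟩ ⟨⟨h0, h1⟩, -⟩
      simp only [axisDist]
      rw [min_eq_left h1, max_eq_right h0.le, sub_self, zero_pow two_ne_zero, zero_add,
        Real.sqrt_sq_eq_abs]
    rw [setLIntegral_congr_fun hM this, Measure.volume_eq_prod,
      setLIntegral_prod _ (by fun_prop)]
    simp only [Measure.restrict_univ, lintegral_comp_abs, lintegral_const,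
      Measure.restrict_apply_univ, Real.volume_Ioc, sub_zero]
    rw [lintegral_mul_const _ hF, mul_comm 2, mul_assoc,
      ENNReal.ofReal_mul zero_le_two, ENNReal.ofReal_ofNat]
  have e3 : ∫⁻ z in {z : ℝ × ℝ | h < z.1}, F (axisDist h z) = ∫⁻ z in Lᶜ, G z := by
    have : ∀ z ∈ {z : ℝ × ℝ | h < z.1}, F (axisDist h z) = Lᶜ.indicator G (z - (h, 0)) := by
      intro z (hz : h < z.1)
      rw [indicator_of_mem (by simpa [L] using hz)]
      simp only [axisDist, G, Prod.fst_sub, Prod.snd_sub, sub_zero]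
      rw [min_eq_right hz.le, max_eq_right hh]
    rw [setLIntegral_congr_fun hR this, ← lintegral_indicator hL.compl,
      ← lintegral_sub_right_eq_self (Lᶜ.indicator G) ((h, 0) : ℝ × ℝ), ← lintegral_indicator hR]
    congr 1 with z
    by_cases hz : h < z.1
    · rw [indicator_of_mem (show z ∈ {z : ℝ × ℝ | h < z.1} from hz)]
    · rw [indicator_of_notMem (show z ∉ {z : ℝ × ℝ | h < z.1} from hz), indicator_of_notMem]
      simpa [L] using hz
  have hcompl : Lᶜ = M ∪ {z : ℝ × ℝ | h < z.1} := by
    ext ⟨s, t⟩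
    simp only [L, M, mem_compl_iff, mem_ofPred_eq, mem_union, mem_prod, mem_Ioc, mem_univ, and_true,
      not_le]
    constructor
    · intro h0; exact (le_or_gt s h).imp (fun h1 => ⟨h0, h1⟩) id
    · rintro (⟨h0, -⟩ | h1)
      · exact h0
      · linarith
  have hdisj : Disjoint M {z : ℝ × ℝ | h < z.1} := by
    rw [Set.disjoint_left]
    rintro ⟨s, t⟩ ⟨⟨-, h1⟩, -⟩ (h2 : h < s)
    linarith [show s ≤ h from h1]
  rw [← lintegral_add_compl _ hL, hcompl, lintegral_union hR hdisj, e1, e2, e3, add_left_comm,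
    lintegral_add_compl _ hL, lintegral_radial hF, ← lintegral_add_left (by fun_prop)]
  refine setLIntegral_congr_fun measurableSet_Ioi fun r hr => ?_
  have hr' : (0 : ℝ) < r := hr
  rw [← mul_add, ← ENNReal.ofReal_add (by positivity) (by positivity), add_comm (2 * h)]

/-- Coarea formula for the distance from a segment of the plane. -/
theorem lintegral_infDist_segment {F : ℝ → ENNReal} (hF : Measurable F) (p q : Plane) :
    ∫⁻ x, F (Metric.infDist x (segment ℝ p q)) =
      ∫⁻ r in Ioi 0, F r * ENNReal.ofReal (2 * Real.pi * r + 2 * dist p q) := by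
  obtain ⟨T, hT, hd⟩ := exists_coordinates_infDist_segment p q
  simp_rw [hd]
  rw [hT.lintegral_comp (f := fun z => F (axisDist (dist p q) z))
    (hF.comp (continuous_axisDist _).measurable), lintegral_axisDist hF dist_nonneg]

/-- With `c = dist p q / π` the area is `∫ 2πρ dρ` over `c < ρ < t`, which is `π(t² - c²)` when `t >
c`; otherwise the set is empty. -/
theorem volume_infDist_segment_lt_le (p q : Plane) (t : ℝ) :
    volume {x | Metric.infDist x (segment ℝ p q) + dist p q / Real.pi < t} ≤
      ENNReal.ofReal (Real.pi * t ^ 2) := by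
  have hπ := Real.pi_pos
  set c := dist p q / Real.pi with hc
  have hcd : dist p q = Real.pi * c := by rw [hc]; field_simp
  have hc0 : 0 ≤ c := by positivity
  have hm : MeasurableSet {r : ℝ | r + c < t} :=
    measurableSet_lt (by fun_prop) measurable_const
  have h1 : volume {x | Metric.infDist x (segment ℝ p q) + c < t} =
      ∫⁻ x, ({r : ℝ | r + c < t}.indicator 1 : ℝ → ENNReal) (Metric.infDist x (segment ℝ p q)) := by
    rw [← lintegral_indicator_one (measurableSet_lt (by fun_prop) measurable_const)]
    rfl
  rw [h1, lintegral_infDist_segment (measurable_one.indicator hm)]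
  rcases le_or_gt t c with htc | htc
  · refine (le_of_eq ?_).trans zero_le
    refine setLIntegral_eq_zero measurableSet_Ioi fun r hr => ?_
    have hr' : (0 : ℝ) < r := hr
    rw [indicator_of_notMem (by simp only [mem_ofPred_eq]; linarith)]; simp
  · have h2 : ∫⁻ r in Ioi 0, ({r : ℝ | r + c < t}.indicator 1 : ℝ → ENNReal) r *
        ENNReal.ofReal (2 * Real.pi * r + 2 * dist p q) ≤
        ∫⁻ r in Ioc 0 (t - c), ENNReal.ofReal (2 * Real.pi * (r + c)) := by
      rw [← lintegral_indicator measurableSet_Ioi, ← lintegral_indicator measurableSet_Ioc]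
      refine lintegral_mono fun r => ?_
      by_cases hr : 0 < r
      · by_cases hr2 : r + c < t
        · rw [indicator_of_mem (show r ∈ Ioi 0 from hr), indicator_of_mem (show r ∈ {r : ℝ | r + c < t} from hr2),
            indicator_of_mem (show r ∈ Ioc 0 (t - c) from ⟨hr, by linarith⟩), hcd]
          simp only [Pi.one_apply, one_mul]
          exact ENNReal.ofReal_le_ofReal (by linarith)
        · rw [indicator_of_mem (show r ∈ Ioi 0 from hr), indicator_of_notMem (show r ∉ {r : ℝ | r + c < t} from hr2)]; simp
      · rw [indicator_of_notMem (show r ∉ Ioi 0 from hr)]; simp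
    refine h2.trans ?_
    rw [← ofReal_integral_eq_lintegral_ofReal]
    · refine ENNReal.ofReal_le_ofReal ?_
      rw [← intervalIntegral.integral_of_le (by linarith), intervalIntegral.integral_const_mul,
        intervalIntegral.integral_comp_add_right (fun x => x), integral_id]
      nlinarith [mul_nonneg hπ.le (sq_nonneg c)]
    · exact (Continuous.integrableOn_Icc (by fun_prop)).mono_set Ioc_subset_Icc_self
    · refine (ae_restrict_iff' measurableSet_Ioc).2 (.of_forall fun r hr => ?_)
      have := hr.1
      simp only [Pi.zero_apply]; positivity

/-- In the shifted variable `ρ` the length density `2πρ` turns `ρ⁻²` into `2πρ⁻¹`, whose integral is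
logarithmic. -/
theorem lintegral_infDist_segment_sq_inv_le (p q : Plane) {s t : ℝ}
    (hs : dist p q / Real.pi < s) (hst : s ≤ t) :
    ∫⁻ x, ({r : ℝ | s < r + dist p q / Real.pi ∧ r + dist p q / Real.pi < t}.indicator
        fun r => ENNReal.ofReal ((r + dist p q / Real.pi)⁻¹ ^ 2))
          (Metric.infDist x (segment ℝ p q)) ≤
      ENNReal.ofReal (2 * Real.pi * Real.log (t / s)) := by
  have hπ := Real.pi_pos
  set c := dist p q / Real.pi with hc
  have hcd : dist p q = Real.pi * c := by rw [hc]; field_simp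
  have hc0 : 0 ≤ c := by positivity
  have hs0 : 0 < s := by linarith
  have hm : MeasurableSet {r : ℝ | s < r + c ∧ r + c < t} :=
    measurableSet_Ioo.preimage (measurable_id.add_const c)
  rw [lintegral_infDist_segment (Measurable.indicator (by fun_prop) hm)]
  have h2 : ∫⁻ r in Ioi 0, ({r : ℝ | s < r + c ∧ r + c < t}.indicator
        fun r => ENNReal.ofReal ((r + c)⁻¹ ^ 2)) r *
        ENNReal.ofReal (2 * Real.pi * r + 2 * dist p q) ≤
        ∫⁻ r in Ioc (s - c) (t - c), ENNReal.ofReal (2 * Real.pi * (r + c)⁻¹) := by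
    refine (setLIntegral_le_lintegral _ _).trans ?_
    rw [← lintegral_indicator measurableSet_Ioc]
    refine lintegral_mono fun r => ?_
    by_cases hr : s < r + c ∧ r + c < t
    · have hrc : 0 < r + c := by linarith
      simp only
      rw [indicator_of_mem (show r ∈ {r : ℝ | s < r + c ∧ r + c < t} from hr),
        indicator_of_mem (show r ∈ Ioc (s - c) (t - c) from ⟨by linarith, by linarith⟩), hcd,
        ← ENNReal.ofReal_mul (by positivity)]
      refine ENNReal.ofReal_le_ofReal (le_of_eq ?_)
      field_simp
    · simp only
      rw [indicator_of_notMem (show r ∉ {r : ℝ | s < r + c ∧ r + c < t} from hr)]; simp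
  refine h2.trans ?_
  rw [← ofReal_integral_eq_lintegral_ofReal]
  · refine ENNReal.ofReal_le_ofReal ?_
    rw [← intervalIntegral.integral_of_le (by linarith), intervalIntegral.integral_const_mul,
      intervalIntegral.integral_comp_add_right (fun x => x⁻¹), sub_add_cancel, sub_add_cancel,
      integral_inv_of_pos hs0 (by linarith)]
  · refine (ContinuousOn.integrableOn_Icc ?_).mono_set Ioc_subset_Icc_self
    refine continuousOn_const.mul (ContinuousOn.inv₀ (by fun_prop) fun r hr => ?_)
    have := hr.1
    linarith
  · refine (ae_restrict_iff' measurableSet_Ioc).2 (.of_forall fun r hr => ?_)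
    have h1 := hr.1
    have : 0 < r + c := by linarith
    simp only [Pi.zero_apply]; positivity

/-! ### The logarithmic cutoff and its energy -/

/-- The distance from the segment `[p, q]`, shifted by `|p - q| / π` and truncated to `[s, t]`. -/
def truncatedDist (p q : Plane) (s t : ℝ) (x : Plane) : ℝ :=
  max s (min t (Metric.infDist x (segment ℝ p q) + dist p q / Real.pi))

/-- The logarithmic cutoff near the segment `[p, q]`. -/
def segmentCutoff (p q : Plane) (s t : ℝ) (x : Plane) : ℝ :=
  Real.log (truncatedDist p q s t x / s) / Real.log (t / s)

section segmentCutoff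
variable {p q : Plane} {s t : ℝ}

theorem le_truncatedDist (x : Plane) : s ≤ truncatedDist p q s t x := le_max_left _ _

theorem truncatedDist_le (hst : s ≤ t) (x : Plane) : truncatedDist p q s t x ≤ t :=
  max_le hst (min_le_left _ _)

theorem lipschitzWith_truncatedDist : LipschitzWith 1 (truncatedDist p q s t) := by
  have h : LipschitzWith 1 fun x : Plane =>
      Metric.infDist x (segment ℝ p q) + dist p q / Real.pi := by
    refine LipschitzWith.of_dist_le_mul fun x y => ?_
    rw [Real.dist_eq, add_sub_add_right_eq_sub, ← Real.dist_eq]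
    exact (Metric.lipschitz_infDist_pt _).dist_le_mul x y
  exact (h.const_min t).const_max s

theorem segmentCutoff_nonneg (hs : 0 < s) (hst : s < t) (x : Plane) :
    0 ≤ segmentCutoff p q s t x :=
  div_nonneg (Real.log_nonneg ((one_le_div hs).2 (le_truncatedDist x)))
    (Real.log_nonneg ((one_le_div hs).2 hst.le))

theorem segmentCutoff_le_one (hs : 0 < s) (hst : s < t) (x : Plane) :
    segmentCutoff p q s t x ≤ 1 := by
  refine div_le_one_of_le₀ (Real.log_le_log ?_ ?_) (Real.log_nonneg ((one_le_div hs).2 hst.le))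
  · exact div_pos (hs.trans_le (le_truncatedDist x)) hs
  · exact div_le_div_of_nonneg_right (truncatedDist_le hst.le x) hs.le

theorem segmentCutoff_eq_zero (hs : 0 < s) {x : Plane}
    (hx : Metric.infDist x (segment ℝ p q) + dist p q / Real.pi ≤ s) :
    segmentCutoff p q s t x = 0 := by
  rw [segmentCutoff, truncatedDist, max_eq_left ((min_le_right _ _).trans hx), div_self hs.ne',
    Real.log_one, zero_div]

theorem segmentCutoff_eq_one (hs : 0 < s) (hst : s < t) {x : Plane}
    (hx : t ≤ Metric.infDist x (segment ℝ p q) + dist p q / Real.pi) :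
    segmentCutoff p q s t x = 1 := by
  rw [segmentCutoff, truncatedDist, min_eq_left hx, max_eq_right hst.le, div_self]
  exact (Real.log_pos ((one_lt_div hs).2 hst)).ne'

/-- The truncated distance is 1-Lipschitz and at least `s`, where the logarithm has slope at most
`s⁻¹`. -/
theorem exists_lipschitzWith_segmentCutoff (hs : 0 < s) (hst : s < t) :
    ∃ K, LipschitzWith K (segmentCutoff p q s t) := by
  have hL := Real.log_pos ((one_lt_div hs).2 hst)
  have key : ∀ x y : Plane, segmentCutoff p q s t x ≤
      segmentCutoff p q s t y + (s⁻¹ / Real.log (t / s)) * dist x y := by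
    intro x y
    have hx := hs.trans_le (le_truncatedDist (p := p) (q := q) (s := s) (t := t) x)
    have hy := hs.trans_le (le_truncatedDist (p := p) (q := q) (s := s) (t := t) y)
    have h1 : truncatedDist p q s t x ≤ truncatedDist p q s t y + dist x y := by
      have := (lipschitzWith_truncatedDist (p := p) (q := q) (s := s) (t := t)).dist_le_mul x y
      rw [Real.dist_eq, NNReal.coe_one, one_mul] at this
      linarith [le_abs_self (truncatedDist p q s t x - truncatedDist p q s t y)]
    have h2 : Real.log (truncatedDist p q s t x / s) ≤
        Real.log (truncatedDist p q s t y / s) + s⁻¹ * dist x y := by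
      rw [Real.log_div hx.ne' hs.ne', Real.log_div hy.ne' hs.ne']
      have h3 := Real.log_le_sub_one_of_pos (div_pos hx hy)
      rw [Real.log_div hx.ne' hy.ne'] at h3
      have h4 : truncatedDist p q s t x / truncatedDist p q s t y - 1 ≤ s⁻¹ * dist x y := by
        rw [div_sub_one hy.ne', inv_mul_eq_div]
        exact div_le_div₀ dist_nonneg (by linarith) hs (le_truncatedDist y)
      linarith
    rw [segmentCutoff, segmentCutoff, div_mul_eq_mul_div, ← add_div]
    exact div_le_div_of_nonneg_right h2 hL.le
  exact ⟨_, LipschitzWith.of_le_add_mul' _ key⟩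

/-- By Rademacher's theorem the chain rule applies almost everywhere, and the 1-Lipschitz truncated
distance has gradient of norm at most one. -/
theorem ae_norm_fderiv_segmentCutoff_le (hs : dist p q / Real.pi < s) (hst : s < t) :
    ∀ᵐ x : Plane, DifferentiableAt ℝ (segmentCutoff p q s t) x ∧
      ENNReal.ofReal (‖fderiv ℝ (segmentCutoff p q s t) x‖ ^ 2) ≤
        ENNReal.ofReal ((Real.log (t / s))⁻¹ ^ 2) *
        ({r : ℝ | s < r + dist p q / Real.pi ∧ r + dist p q / Real.pi < t}.indicator
        fun r => ENNReal.ofReal ((r + dist p q / Real.pi)⁻¹ ^ 2))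
          (Metric.infDist x (segment ℝ p q)) := by
  have hs0 : 0 < s := lt_of_le_of_lt (by positivity) hs
  have hL := Real.log_pos ((one_lt_div hs0).2 hst)
  filter_upwards [(lipschitzWith_truncatedDist (p := p) (q := q) (s := s)
    (t := t)).ae_differentiableAt] with x hx
  have hpos : 0 < truncatedDist p q s t x := hs0.trans_le (le_truncatedDist x)
  have hd : HasFDerivAt (segmentCutoff p q s t) ((Real.log (t / s))⁻¹ •
      ((truncatedDist p q s t x)⁻¹ • fderiv ℝ (truncatedDist p q s t) x)) x := by
    have h1 := (hx.hasFDerivAt.mul_const s⁻¹).log (by positivity)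
    have h2 := h1.mul_const (Real.log (t / s))⁻¹
    refine (h2.congr_fderiv ?_).congr_of_eventuallyEq (.of_forall fun y => ?_)
    · ext v
      simp only [smul_apply, smul_eq_mul]
      field_simp
    · simp [segmentCutoff, div_eq_mul_inv]
  refine ⟨hd.differentiableAt, ?_⟩
  rw [hd.fderiv]
  have hnorm : ‖fderiv ℝ (truncatedDist p q s t) x‖ ≤ 1 := by
    simpa using norm_fderiv_le_of_lipschitz ℝ (lipschitzWith_truncatedDist (p := p) (q := q)
      (s := s) (t := t)) (x₀ := x)
  by_cases h : s < Metric.infDist x (segment ℝ p q) + dist p q / Real.pi ∧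
      Metric.infDist x (segment ℝ p q) + dist p q / Real.pi < t
  · rw [indicator_of_mem (show Metric.infDist x (segment ℝ p q) ∈
      {r : ℝ | s < r + dist p q / Real.pi ∧ r + dist p q / Real.pi < t} from h)]
    have hv : truncatedDist p q s t x =
        Metric.infDist x (segment ℝ p q) + dist p q / Real.pi := by
      rw [truncatedDist, min_eq_right h.2.le, max_eq_right h.1.le]
    rw [← hv, ← ENNReal.ofReal_mul (by positivity)]
    refine ENNReal.ofReal_le_ofReal ?_
    rw [norm_smul, norm_smul, ← mul_pow, Real.norm_of_nonneg (by positivity),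
      Real.norm_of_nonneg (by positivity)]
    gcongr
    exact mul_le_of_le_one_right (by positivity) hnorm
  -- Outside the shell the truncated distance takes its extreme value `s` or `t`, so a derivative
  -- there vanishes by Fermat's rule, even on the edge of the shell.
  · have h0 : fderiv ℝ (truncatedDist p q s t) x = 0 := by
      rcases not_and_or.1 h with h1 | h1
      · refine IsLocalMin.fderiv_eq_zero (.of_forall fun y => ?_)
        have : truncatedDist p q s t x = s := by
          rw [truncatedDist, max_eq_left ((min_le_right _ _).trans (not_lt.1 h1))]
        rw [this]; exact le_truncatedDist y
      · refine IsLocalMax.fderiv_eq_zero (.of_forall fun y => ?_)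
        have : truncatedDist p q s t x = t := by
          rw [truncatedDist, min_eq_left (not_lt.1 h1), max_eq_right hst.le]
        rw [this]; exact truncatedDist_le hst.le y
    rw [h0]; simp

theorem lintegral_fderiv_segmentCutoff_le (hs : dist p q / Real.pi < s) (hst : s < t) :
    ∫⁻ x, ENNReal.ofReal (‖fderiv ℝ (segmentCutoff p q s t) x‖ ^ 2) ≤
      ENNReal.ofReal (2 * Real.pi / Real.log (t / s)) := by
  have hs0 : 0 < s := lt_of_le_of_lt (by positivity) hs
  have hL := Real.log_pos ((one_lt_div hs0).2 hst)
  refine (lintegral_mono_ae ((ae_norm_fderiv_segmentCutoff_le hs hst).mono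
    fun x hx => hx.2)).trans ?_
  rw [lintegral_const_mul' _ _ ENNReal.ofReal_ne_top]
  refine (mul_le_mul_right (lintegral_infDist_segment_sq_inv_le p q hs hst.le) _).trans ?_
  rw [← ENNReal.ofReal_mul (by positivity)]
  refine ENNReal.ofReal_le_ofReal (le_of_eq ?_)
  field_simp

end segmentCutoff

/-! ### Energy of a minimum of finitely many functions -/

section minimum
variable {ι E : Type*} [Fintype ι] [Nonempty ι] {f : ι → E → ℝ}

/-- The pointwise minimum of a finite family of functions. -/
def finMin (f : ι → E → ℝ) (x : E) : ℝ := Finset.univ.inf' Finset.univ_nonempty fun j => f j x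

theorem finMin_le (j : ι) (x : E) : finMin f x ≤ f j x :=
  Finset.inf'_le _ (Finset.mem_univ j)

theorem exists_finMin_eq (x : E) : ∃ j, finMin f x = f j x := by
  obtain ⟨j, -, hj⟩ := Finset.exists_mem_eq_inf' (Finset.univ_nonempty (α := ι)) fun j => f j x
  exact ⟨j, hj⟩

theorem exists_lipschitzWith_finMin [PseudoMetricSpace E] (hf : ∀ j, ∃ K, LipschitzWith K (f j)) :
    ∃ K, LipschitzWith K (finMin f) := by
  choose K hK using hf
  refine ⟨∑ j, K j, LipschitzWith.of_le_add_mul _ fun x y => ?_⟩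
  obtain ⟨j, hj⟩ := exists_finMin_eq (f := f) y
  have h1 := (hK j).dist_le_mul x y
  rw [Real.dist_eq] at h1
  have h2 : (K j : ℝ) * dist x y ≤ (∑ j, K j : NNReal) * dist x y := by
    gcongr
    exact Finset.single_le_sum (f := K) (fun _ _ => zero_le) (Finset.mem_univ j)
  rw [hj]
  linarith [finMin_le (f := f) j x, le_abs_self (f j x - f j y)]

/-- If `f j` attains the minimum at `x`, then `f j - finMin f` is non-negative and vanishes at `x`,
so its derivative there is zero. -/
theorem exists_fderiv_finMin_eq [NormedAddCommGroup E] [NormedSpace ℝ E] {x : E}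
    (h : DifferentiableAt ℝ (finMin f) x) (hf : ∀ j, DifferentiableAt ℝ (f j) x) :
    ∃ j, fderiv ℝ (finMin f) x = fderiv ℝ (f j) x := by
  obtain ⟨j, hj⟩ := exists_finMin_eq (f := f) x
  have hmin : IsLocalMin (fun y => f j y - finMin f y) x := by
    refine .of_forall fun y => ?_
    simp only [hj, sub_self]
    exact sub_nonneg.2 (finMin_le j y)
  have := hmin.fderiv_eq_zero
  rw [fderiv_fun_sub (hf j) h, sub_eq_zero] at this
  exact ⟨j, this.symm⟩

end minimum

theorem lintegral_fderiv_finMin_le {ι : Type*} [Fintype ι] [Nonempty ι] {f : ι → Plane → ℝ}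
    (hf : ∀ j, ∃ K, LipschitzWith K (f j)) :
    ∫⁻ x, ENNReal.ofReal (‖fderiv ℝ (finMin f) x‖ ^ 2) ≤
      ∑ j, ∫⁻ x, ENNReal.ofReal (‖fderiv ℝ (f j) x‖ ^ 2) := by
  obtain ⟨K, hK⟩ := exists_lipschitzWith_finMin hf
  have hd : ∀ᵐ x : Plane, ∀ j, DifferentiableAt ℝ (f j) x :=
    ae_all_iff.2 fun j => (hf j).choose_spec.ae_differentiableAt
  rw [← lintegral_finsetSum _ fun j _ => (measurable_fderiv ℝ (f j)).norm.pow_const 2 |>.ennreal_ofReal]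
  refine lintegral_mono_ae ?_
  filter_upwards [hK.ae_differentiableAt, hd] with x hx hxj
  obtain ⟨j, hj⟩ := exists_fderiv_finMin_eq hx hxj
  rw [hj]
  exact Finset.single_le_sum (f := fun j => ENNReal.ofReal (‖fderiv ℝ (f j) x‖ ^ 2))
    (fun _ _ => zero_le) (Finset.mem_univ j)

/-- Evaluate `ℓ` on the vector representing it. -/
theorem sum_sq_apply_stdVec_le (ℓ : Plane →L[ℝ] ℝ) : ∑ j, ℓ (stdVec j) ^ 2 ≤ ‖ℓ‖ ^ 2 := by
  set v : Plane := ∑ j, ℓ (stdVec j) • stdVec j with hv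
  have h1 : ℓ v = ∑ j, ℓ (stdVec j) ^ 2 := by
    rw [hv, map_sum]; simp [sq]
  have h2 : ‖v‖ ^ 2 = ∑ j, ℓ (stdVec j) ^ 2 := by
    rw [EuclideanSpace.norm_sq_eq]
    simp [hv, stdVec]
  have h3 := (le_abs_self _).trans (ℓ.le_opNorm v)
  rw [h1, ← h2] at h3
  rw [← h2]
  rcases (norm_nonneg v).eq_or_lt with h0 | h0
  · rw [← h0, zero_pow two_ne_zero]; positivity
  · have : ‖v‖ ≤ ‖ℓ‖ := le_of_mul_le_mul_right (by rwa [← sq]) h0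
    gcongr

/-! ### Integration by parts with a locally defined phase -/

section gauge
open scoped Topology Manifold
variable {E : Type*} [NormedAddCommGroup E] [NormedSpace ℝ E] [FiniteDimensional ℝ E]

theorem exists_contDiff_one_nhds_of_isCompact {K U : Set E} (hK : IsCompact K) (hU : IsOpen U)
    (hKU : K ⊆ U) : ∃ χ : E → ℝ, ContDiff ℝ ∞ χ ∧ HasCompactSupport χ ∧ tsupport χ ⊆ U ∧
      ∀ x ∈ K, χ =ᶠ[𝓝 x] 1 := by
  obtain ⟨t, ht, hKt, htU⟩ := exists_compact_between hK hU hKU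
  obtain ⟨χ, h1, h0, -⟩ := exists_contMDiffMap_one_nhds_of_subset_interior 𝓘(ℝ, E) (n := ⊤)
    hK.isClosed hKt
  have hsupp : tsupport χ ⊆ t := closure_minimal
    (fun x hx => by_contra fun hxt => hx (h0 x hxt)) ht.isClosed
  refine ⟨χ, χ.contMDiff.contDiff, ht.of_isClosed_subset (isClosed_tsupport _) hsupp,
    hsupp.trans htU, fun x hx => ?_⟩
  exact Filter.Eventually.filter_mono (nhds_le_nhdsSet hx) h1

variable [MeasurableSpace E] [BorelSpace E] {μ : Measure E} [μ.IsAddHaarMeasure]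

theorem integral_lineDeriv_mul_add_eq_zero {φ G : E → ℝ} {K : NNReal} (hφ : LipschitzWith K φ)
    (hG : ContDiff ℝ 1 G) (hGc : HasCompactSupport G) (v : E) :
    ∫ x, (lineDeriv ℝ φ x v * G x + φ x * fderiv ℝ G x v) ∂μ = 0 := by
  obtain ⟨D, hD⟩ := hG.lipschitzWith_of_hasCompactSupport hGc one_ne_zero
  have hlin : ∀ x, lineDeriv ℝ G x (-v) = - fderiv ℝ G x v := fun x => by
    rw [(hG.differentiable one_ne_zero x).lineDeriv_eq_fderiv, map_neg]
  have hGi : Integrable G μ := hG.continuous.integrable_of_hasCompactSupport hGc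
  have hi1 : Integrable (fun x => lineDeriv ℝ φ x v * G x) μ :=
    hGi.bdd_mul (measurable_lineDeriv hφ.continuous).aestronglyMeasurable
      (.of_forall fun x => norm_lineDeriv_le_of_lipschitz ℝ hφ)
  have hi2 : Integrable (fun x => φ x * fderiv ℝ G x v) μ := by
    refine Continuous.integrable_of_hasCompactSupport
      (hφ.continuous.mul ((hG.continuous_fderiv one_ne_zero).clm_apply continuous_const)) ?_
    exact (hGc.fderiv_apply ℝ v).mul_left
  have h := LipschitzWith.integral_lineDeriv_mul_eq (μ := μ) hφ hD hGc v
  rw [integral_add hi1 hi2, h, ← integral_add]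
  · simp [hlin, mul_comm]
  · simpa [hlin, mul_comm] using hi2.neg
  · exact hi2

/-- Integration by parts for a Lipschitz function times a function of the phase `θ`. -/
theorem integral_gauge_eq_zero {φ ψ θ : E → ℝ} {A : E → (E →L[ℝ] ℝ)} {κ : ℝ → ℝ} {U : Set E}
    {K : NNReal} (hφ : LipschitzWith K φ) (hψ : ContDiff ℝ ∞ ψ) (hψc : HasCompactSupport ψ)
    (hU : IsOpen U) (hsupp : tsupport ψ ∩ tsupport φ ⊆ U) (hA : ContinuousOn A U)
    (hθ : ∀ x ∈ U, HasFDerivAt θ (A x) x) (hκ : ContDiff ℝ 1 κ) (v : E) :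
    ∫ x, (lineDeriv ℝ φ x v * (ψ x * κ (θ x)) +
      φ x * (fderiv ℝ ψ x v * κ (θ x) + ψ x * (deriv κ (θ x) * A x v))) ∂μ = 0 := by
  -- The phase `θ` is controlled only on `U`. Multiplying by `χ` makes `ψ κ(θ)` globally `C¹`, and
  -- changes nothing near points where both `ψ` and `φ` matter.
  obtain ⟨χ, hχ, hχc, hχU, hχ1⟩ := exists_contDiff_one_nhds_of_isCompact
    (hψc.isCompact.inter_right (isClosed_tsupport φ)) hU hsupp
  have hθ1 : ContDiffOn ℝ 1 θ U := by
    rw [show (1 : WithTop ℕ∞) = 0 + 1 by simp, contDiffOn_succ_iff_fderiv_of_isOpen hU]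
    exact ⟨fun x hx => (hθ x hx).differentiableAt.differentiableWithinAt, by simp,
      contDiffOn_zero.2 (hA.congr fun x hx => (hθ x hx).fderiv)⟩
  have hG : ContDiff ℝ 1 fun x => χ x * (ψ x * κ (θ x)) := by
    rw [contDiff_iff_contDiffAt]
    intro x
    by_cases hx : x ∈ tsupport χ
    · exact (hχ.contDiffAt.of_le (by simp)).mul ((hψ.contDiffAt.of_le (by simp)).mul
        (hκ.contDiffAt.comp x (hθ1.contDiffAt (hU.mem_nhds (hχU hx)))))
    · refine (contDiffAt_const (c := (0 : ℝ))).congr_of_eventuallyEq ?_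
      filter_upwards [notMem_tsupport_iff_eventuallyEq.1 hx] with y hy
      simp [hy]
  have h0 := integral_lineDeriv_mul_add_eq_zero (μ := μ) hφ hG hχc.mul_right v
  rw [← h0]
  congr 1 with x
  by_cases hxφ : x ∈ tsupport φ
  · by_cases hxψ : x ∈ tsupport ψ
    · have h1 := hχ1 x ⟨hxψ, hxφ⟩
      have hxU := hsupp ⟨hxψ, hxφ⟩
      have hd : HasFDerivAt (fun x => χ x * (ψ x * κ (θ x)))
          (ψ x • (deriv κ (θ x) • A x) + κ (θ x) • fderiv ℝ ψ x) x := by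
        refine HasFDerivAt.congr_of_eventuallyEq ((hψ.differentiable (by simp) x).hasFDerivAt.mul
          (((hκ.differentiable one_ne_zero) (θ x)).hasDerivAt.comp_hasFDerivAt x (hθ x hxU))) ?_
        filter_upwards [h1] with y hy
        simp [hy]
      rw [hd.fderiv, h1.eq_of_nhds]
      simp only [Pi.one_apply, add_apply, smul_apply, smul_eq_mul, one_mul]
      ring
    · have h1 := notMem_tsupport_iff_eventuallyEq.1 hxψ
      have h2 : (fun x => χ x * (ψ x * κ (θ x))) =ᶠ[𝓝 x] fun _ => 0 := by
        filter_upwards [h1] with y hy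
        simp [hy]
      have h3 : fderiv ℝ ψ x = 0 := by rw [h1.fderiv_eq]; simp
      rw [h2.fderiv_eq, h3, h1.eq_of_nhds]
      simp
  · have h1 := notMem_tsupport_iff_eventuallyEq.1 hxφ
    have h2 : lineDeriv ℝ φ x v = 0 := by
      rw [h1.lineDeriv_eq]; simp [lineDeriv]
    rw [h2, h1.eq_of_nhds]
    simp
end gauge

/-! ### The gauged cutoff as a test function -/

section testFunction
open scoped Topology
variable {Ω U : Set Plane} {A : Plane → (Plane →L[ℝ] ℝ)} {φ θ : Plane → ℝ}

/-- The gauged cutoff `φ e^{iθ}`. -/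
def gaugedCutoff (U : Set Plane) (φ θ : Plane → ℝ) : Plane → ℂ :=
  U.indicator fun x => (φ x : ℂ) * Complex.exp (θ x * Complex.I)

/-- The weak partial derivatives of the gauged cutoff when `dθ = A`. -/
def gaugedGrad (A : Plane → (Plane →L[ℝ] ℝ)) (U : Set Plane) (φ θ : Plane → ℝ) (j : Fin 2) :
    Plane → ℂ :=
  U.indicator fun x => ((lineDeriv ℝ φ x (stdVec j) : ℝ) + Complex.I * φ x *
    (A x (stdVec j) : ℝ)) * Complex.exp (θ x * Complex.I)

theorem norm_gaugedCutoff_le (hφ1 : ∀ x, |φ x| ≤ 1) (x : Plane) : ‖gaugedCutoff U φ θ x‖ ≤ 1 := by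
  rw [gaugedCutoff, indicator]
  split_ifs
  · rw [norm_mul, Complex.norm_exp_ofReal_mul_I, mul_one, Complex.norm_real]; exact hφ1 x
  · simp

theorem hasH1Gradient_gaugedCutoff (hΩ : IsOpen Ω) (hΩb : Bornology.IsBounded Ω)
    (hA : ContinuousOn A (closure Ω)) (hU : IsOpen U) (hUΩ : U ⊆ Ω)
    (hθ : ∀ x ∈ U, HasFDerivAt θ (A x) x) {K : NNReal} (hφ : LipschitzWith K φ)
    (hφ1 : ∀ x, |φ x| ≤ 1) (hsupp : Ω ∩ tsupport φ ⊆ U) :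
    HasH1Gradient Ω (gaugedCutoff U φ θ) (gaugedGrad A U φ θ) := by
  have : IsFiniteMeasure (volume.restrict Ω) := ⟨by
    rw [Measure.restrict_apply_univ]; exact hΩb.measure_lt_top⟩
  have hrestr : (volume.restrict Ω).restrict U = volume.restrict U := by
    rw [Measure.restrict_restrict hU.measurableSet, inter_eq_left.2 hUΩ]
  have hAU : ContinuousOn A U := hA.mono (hUΩ.trans subset_closure)
  have hexp : ContinuousOn (fun x => Complex.exp (θ x * Complex.I)) U := by
    have : ContinuousOn θ U := fun x hx => (hθ x hx).continuousAt.continuousWithinAt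
    fun_prop
  have hm1 : AEStronglyMeasurable (gaugedCutoff U φ θ) (volume.restrict Ω) := by
    refine (aestronglyMeasurable_indicator_iff hU.measurableSet).2 ?_
    rw [hrestr]
    have := hφ.continuous
    exact ContinuousOn.aestronglyMeasurable
      (ContinuousOn.mul (by fun_prop) hexp) hU.measurableSet
  have hm2 : ∀ j, AEStronglyMeasurable (gaugedGrad A U φ θ j) (volume.restrict Ω) := fun j => by
    refine (aestronglyMeasurable_indicator_iff hU.measurableSet).2 ?_
    rw [hrestr]
    have hc := hφ.continuous
    refine AEStronglyMeasurable.mul (.add ?_ ?_) (hexp.aestronglyMeasurable hU.measurableSet)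
    · exact (Complex.measurable_ofReal.comp (measurable_lineDeriv hc)).aestronglyMeasurable
    · refine ContinuousOn.aestronglyMeasurable (ContinuousOn.mul (by fun_prop) ?_)
        hU.measurableSet
      exact Complex.continuous_ofReal.comp_continuousOn (hAU.clm_apply continuousOn_const)
  obtain ⟨C, hC⟩ := (hΩb.isCompact_closure).exists_bound_of_continuousOn hA
  have hu : MemLp (gaugedCutoff U φ θ) 2 (volume.restrict Ω) :=
    .of_bound hm1 1 (.of_forall fun x => norm_gaugedCutoff_le hφ1 x)
  have hg : ∀ j, MemLp (gaugedGrad A U φ θ j) 2 (volume.restrict Ω) := fun j => by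
    refine .of_bound (hm2 j) (K * ‖stdVec j‖ + C * ‖stdVec j‖)
      ((ae_restrict_iff' hΩ.measurableSet).2 (.of_forall fun x hx => ?_))
    have hCx := hC x (subset_closure hx)
    have hC0 := (norm_nonneg _).trans hCx
    rw [gaugedGrad, indicator]
    split_ifs
    · rw [norm_mul, Complex.norm_exp_ofReal_mul_I, mul_one]
      refine (norm_add_le _ _).trans (add_le_add ?_ ?_)
      · rw [Complex.norm_real]; exact norm_lineDeriv_le_of_lipschitz ℝ hφ
      · rw [norm_mul, norm_mul, Complex.norm_I, one_mul, Complex.norm_real, Complex.norm_real]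
        refine (mul_le_of_le_one_left (norm_nonneg _) (hφ1 x)).trans ?_
        exact ((A x).le_opNorm _).trans (by gcongr)
    · rw [norm_zero]; positivity
  refine ⟨hu, hg, fun j ψ hψ hψc hψΩ => ?_⟩
  have hi1 : Integrable (fun x => ((fderiv ℝ ψ x (stdVec j) : ℝ) : ℂ) * gaugedCutoff U φ θ x)
      (volume.restrict Ω) := by
    have hc : Continuous fun x => fderiv ℝ ψ x (stdVec j) :=
      (hψ.continuous_fderiv (by simp)).clm_apply continuous_const
    obtain ⟨D, hD⟩ := hc.bounded_above_of_compact_support (hψc.fderiv_apply ℝ _)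
    refine (hu.integrable (by norm_num)).bdd_mul (c := D) (by fun_prop) (.of_forall fun x => ?_)
    rw [Complex.norm_real]; exact hD x
  have hi2 : Integrable (fun x => ((ψ x : ℝ) : ℂ) * gaugedGrad A U φ θ j x)
      (volume.restrict Ω) := by
    have hc := hψ.continuous
    obtain ⟨D, hD⟩ := hc.bounded_above_of_compact_support hψc
    refine ((hg j).integrable (by norm_num)).bdd_mul (c := D) (by fun_prop)
      (.of_forall fun x => ?_)
    rw [Complex.norm_real]; exact hD x
  rw [eq_neg_iff_add_eq_zero, ← integral_add hi1 hi2]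
  have hsupp' : tsupport ψ ∩ tsupport φ ⊆ U := fun x hx => hsupp ⟨hψΩ hx.1, hx.2⟩
  have hout : ∀ x ∉ U, ψ x = 0 ∧ fderiv ℝ ψ x = 0 ∨ φ x = 0 ∧ lineDeriv ℝ φ x (stdVec j) = 0 := by
    intro x hx
    by_cases hxψ : x ∈ tsupport ψ
    · right
      have h1 := notMem_tsupport_iff_eventuallyEq.1 fun h => hx (hsupp' ⟨hxψ, h⟩)
      exact ⟨h1.eq_of_nhds, by rw [h1.lineDeriv_eq]; simp [lineDeriv]⟩
    · left
      have h1 := notMem_tsupport_iff_eventuallyEq.1 hxψ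
      exact ⟨h1.eq_of_nhds, by rw [h1.fderiv_eq]; simp⟩
  -- The cosine and sine of the phase give the real and imaginary parts of the weak derivative
  -- identity.
  have hcos := integral_gauge_eq_zero (μ := volume) hφ hψ hψc hU hsupp' hAU hθ
    Real.contDiff_cos (stdVec j)
  have hsin := integral_gauge_eq_zero (μ := volume) hφ hψ hψc hU hsupp' hAU hθ
    Real.contDiff_sin (stdVec j)
  have hΩout : ∀ x ∉ Ω, ψ x = 0 ∧ fderiv ℝ ψ x = 0 := fun x hx => by
    have h1 := notMem_tsupport_iff_eventuallyEq.1 fun h => hx (hψΩ h)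
    exact ⟨h1.eq_of_nhds, by rw [h1.fderiv_eq]; simp⟩
  refine Complex.ext ?_ ?_
  · refine (integral_re (hi1.add hi2)).symm.trans ?_
    rw [Complex.zero_re, ← hcos, setIntegral_eq_integral_of_forall_compl_eq_zero]
    · congr 1 with x
      by_cases hx : x ∈ U
      · simp [gaugedCutoff, gaugedGrad, hx, Complex.exp_ofReal_mul_I_re,
          Complex.exp_ofReal_mul_I_im]
        ring
      · rcases hout x hx with ⟨h1, h2⟩ | ⟨h1, h2⟩ <;>
          simp [gaugedCutoff, gaugedGrad, hx, h1, h2]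
    · intro x hx
      obtain ⟨h1, h2⟩ := hΩout x hx
      simp [h1, h2]
  · refine (integral_im (hi1.add hi2)).symm.trans ?_
    rw [Complex.zero_im, ← hsin, setIntegral_eq_integral_of_forall_compl_eq_zero]
    · congr 1 with x
      by_cases hx : x ∈ U
      · simp [gaugedCutoff, gaugedGrad, hx, Complex.exp_ofReal_mul_I_re,
          Complex.exp_ofReal_mul_I_im]
        ring
      · rcases hout x hx with ⟨h1, h2⟩ | ⟨h1, h2⟩ <;>
          simp [gaugedCutoff, gaugedGrad, hx, h1, h2]
    · intro x hx
      obtain ⟨h1, h2⟩ := hΩout x hx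
      simp [h1, h2]

theorem magneticEnergy_gaugedCutoff_le (hΩ : IsOpen Ω) {K : NNReal} (hφ : LipschitzWith K φ)
    {B : ℝ} (hB : 0 ≤ B)
    (hle : ∫⁻ x, ENNReal.ofReal (‖fderiv ℝ φ x‖ ^ 2) ≤ ENNReal.ofReal B) :
    magneticEnergy Ω A (gaugedCutoff U φ θ) (gaugedGrad A U φ θ) ≤ B := by
  unfold magneticEnergy
  have hm : AEStronglyMeasurable (fun x => ‖fderiv ℝ φ x‖ ^ 2) (volume : Measure Plane) :=
    ((measurable_fderiv ℝ φ).norm.pow_const 2).aestronglyMeasurable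
  have hint : Integrable (fun x => ‖fderiv ℝ φ x‖ ^ 2) (volume : Measure Plane) := by
    refine ⟨hm, ?_⟩
    rw [hasFiniteIntegral_iff_ofReal (.of_forall fun x => by positivity)]
    exact hle.trans_lt ENNReal.ofReal_lt_top
  have hB' : ∫ x, ‖fderiv ℝ φ x‖ ^ 2 ≤ B := by
    rw [integral_eq_lintegral_of_nonneg_ae (.of_forall fun x => by positivity) hm]
    exact ENNReal.toReal_le_of_le_ofReal hB hle
  refine le_trans ?_ ((setIntegral_le_integral (s := Ω) hint
    (.of_forall fun x => by positivity)).trans hB')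
  refine integral_mono_of_nonneg (.of_forall fun x => by positivity) hint.integrableOn ?_
  refine (ae_restrict_iff' hΩ.measurableSet).2 ?_
  filter_upwards [hφ.ae_differentiableAt] with x hx _
  refine le_trans ?_ (sum_sq_apply_stdVec_le (fderiv ℝ φ x))
  refine Finset.sum_le_sum fun j _ => ?_
  by_cases hxU : x ∈ U
  -- The potential terms cancel and leave `∂_j φ` times a number of modulus one.
  · rw [gaugedCutoff, gaugedGrad, indicator_of_mem hxU, indicator_of_mem hxU,
      hx.lineDeriv_eq_fderiv, show ∀ a b c e : ℂ, (a + Complex.I * b * c) * e -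
        Complex.I * (b * e) * c = a * e from fun a b c e => by ring, norm_mul,
      Complex.norm_exp_ofReal_mul_I, mul_one, Complex.norm_real, Real.norm_eq_abs, sq_abs]
  · rw [gaugedCutoff, gaugedGrad, indicator_of_notMem hxU, indicator_of_notMem hxU]
    simpa using sq_nonneg _

end testFunction

/-! ### Rayleigh quotient bounds -/

theorem groundEnergy_le {Ω : Set Plane} {A : Plane → (Plane →L[ℝ] ℝ)} {u : Plane → ℂ}
    {g : Fin 2 → Plane → ℂ} (hu : HasH1Gradient Ω u g) {B M : ℝ}
    (hB : magneticEnergy Ω A u g ≤ B) (hM : 0 < M) (hMu : M ≤ ∫ x in Ω, ‖u x‖ ^ 2) :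
    groundEnergy Ω A ≤ B / M := by
  have hE : ∀ u g, 0 ≤ magneticEnergy Ω A u g := fun u g =>
    integral_nonneg fun x => Finset.sum_nonneg fun _ _ => by positivity
  have hne : ¬ u =ᵐ[volume.restrict Ω] 0 := fun h => by
    have h0 : ∫ x in Ω, ‖u x‖ ^ 2 = 0 := by
      refine integral_eq_zero_of_ae ?_
      filter_upwards [h] with x hx
      simp [hx]
    linarith
  have hbdd : BddBelow {R | ∃ (u : Plane → ℂ) (g : Fin 2 → Plane → ℂ), HasH1Gradient Ω u g ∧
      ¬ (u =ᵐ[volume.restrict Ω] 0) ∧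
      R = magneticEnergy Ω A u g / ∫ x in Ω, ‖u x‖ ^ 2} := by
    refine ⟨0, ?_⟩
    rintro _ ⟨u, g, -, -, rfl⟩
    exact div_nonneg (hE u g) (integral_nonneg fun _ => by positivity)
  exact (csInf_le hbdd ⟨u, g, hu, hne, rfl⟩).trans
    (div_le_div₀ ((hE u g).trans hB) hB hM hMu)

/-- The lowest eigenvalue is bounded by the capacities of shrunken neighbourhoods of the cut. -/
theorem groundEnergy_le_of_isSimplyConnected {ι : Type*} [Fintype ι] [Nonempty ι] {Ω : Set Plane}
    {A : Plane → (Plane →L[ℝ] ℝ)} (hΩ : IsOpen Ω) (hΩb : Bornology.IsBounded Ω)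
    (hA : IsClosedPotential Ω A) (Γ : ι → Plane × Plane)
    (hsc : IsSimplyConnected (Ω \ ⋃ j, segment ℝ (Γ j).1 (Γ j).2)) {s t : ι → ℝ}
    (hs : ∀ j, dist (Γ j).1 (Γ j).2 / Real.pi < s j) (hst : ∀ j, s j < t j)
    (hvol : ∑ j, Real.pi * t j ^ 2 < volume.real Ω) :
    groundEnergy Ω A ≤ (∑ j, 2 * Real.pi / Real.log (t j / s j)) /
      (volume.real Ω - ∑ j, Real.pi * t j ^ 2) := by
  set U := Ω \ ⋃ j, segment ℝ (Γ j).1 (Γ j).2 with hUdef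
  have hs0 : ∀ j, 0 < s j := fun j => lt_of_le_of_lt (by positivity) (hs j)
  have hclosed : ∀ j, IsClosed (segment ℝ (Γ j).1 (Γ j).2) := fun j => by
    rw [segment_eq_image']
    exact (isCompact_Icc.image (by fun_prop)).isClosed
  have hU : IsOpen U := hΩ.sdiff (isClosed_iUnion_of_finite hclosed)
  have hUΩ : U ⊆ Ω := sdiff_subset
  have hAd : DifferentiableOn ℝ A Ω :=
    (hA.smooth.mono subset_closure).differentiableOn (by simp)
  obtain ⟨θ, hθ⟩ := hsc.exists_hasFDerivAt hU (hAd.mono hUΩ) fun x hx => hA.closed x (hUΩ hx)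
  let f : ι → Plane → ℝ := fun j => segmentCutoff (Γ j).1 (Γ j).2 (s j) (t j)
  have hf : ∀ j, ∃ K, LipschitzWith K (f j) := fun j =>
    exists_lipschitzWith_segmentCutoff (hs0 j) (hst j)
  obtain ⟨K, hK⟩ := exists_lipschitzWith_finMin hf
  have hφ0 : ∀ x, 0 ≤ finMin f x := fun x => by
    obtain ⟨j, hj⟩ := exists_finMin_eq (f := f) x
    rw [hj]; exact segmentCutoff_nonneg (hs0 j) (hst j) x
  have hφ1 : ∀ x, |finMin f x| ≤ 1 := fun x => by
    obtain ⟨j, hj⟩ := exists_finMin_eq (f := f) x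
    rw [abs_of_nonneg (hφ0 x), hj]; exact segmentCutoff_le_one (hs0 j) (hst j) x
  -- On the support of the minimum every shifted distance is at least `s j`, whereas on the `j`-th
  -- segment it equals `dist / π < s j`.
  have hsupp : Ω ∩ tsupport (finMin f) ⊆ U := by
    rintro x ⟨hxΩ, hx⟩
    refine ⟨hxΩ, fun hxΓ => ?_⟩
    obtain ⟨j, hj⟩ := mem_iUnion.1 hxΓ
    have hsub : tsupport (finMin f) ⊆ {y | s j ≤ Metric.infDist y (segment ℝ (Γ j).1 (Γ j).2) +
        dist (Γ j).1 (Γ j).2 / Real.pi} := by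
      refine closure_minimal (fun y hy => ?_) (isClosed_le continuous_const
        ((Metric.continuous_infDist_pt _).add continuous_const))
      by_contra h
      refine hy (le_antisymm ((finMin_le j y).trans_eq ?_) (hφ0 y))
      exact segmentCutoff_eq_zero (hs0 j) (not_le.1 h).le
    have h1 : s j ≤ _ := hsub hx
    rw [Metric.infDist_zero_of_mem hj, zero_add] at h1
    exact absurd h1 (not_le.2 (hs j))
  have hH1 := hasH1Gradient_gaugedCutoff hΩ hΩb hA.smooth.continuousOn hU hUΩ hθ hK hφ1 hsupp
  have hpos : ∀ j, 0 ≤ 2 * Real.pi / Real.log (t j / s j) := fun j =>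
    div_nonneg (by positivity) (Real.log_nonneg ((one_le_div (hs0 j)).2 (hst j).le))
  refine groundEnergy_le hH1 (magneticEnergy_gaugedCutoff_le hΩ hK
    (Finset.sum_nonneg fun j _ => hpos j) ?_) (sub_pos.2 hvol) ?_
  · refine (lintegral_fderiv_finMin_le hf).trans ?_
    rw [ENNReal.ofReal_sum_of_nonneg fun j _ => hpos j]
    exact Finset.sum_le_sum fun j _ => lintegral_fderiv_segmentCutoff_le (hs j) (hst j)
  -- Off the union of the `W j` all cutoffs equal one, so the mass is at least the area of what
  -- remains of `Ω`.
  · let W : ι → Set Plane := fun j => {x | Metric.infDist x (segment ℝ (Γ j).1 (Γ j).2) +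
      dist (Γ j).1 (Γ j).2 / Real.pi < t j}
    have hWm : MeasurableSet (⋃ j, W j) := MeasurableSet.iUnion fun j =>
      measurableSet_lt ((Metric.continuous_infDist_pt _).add continuous_const).measurable
        measurable_const
    have hWv : ∀ j, volume (W j) ≤ ENNReal.ofReal (Real.pi * t j ^ 2) := fun j =>
      volume_infDist_segment_lt_le _ _ _
    have hWreal : volume.real (⋃ j, W j) ≤ ∑ j, Real.pi * t j ^ 2 :=
      (measureReal_iUnion_fintype_le _).trans (Finset.sum_le_sum fun j _ =>
        ENNReal.toReal_le_of_le_ofReal (by positivity) (hWv j))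
    have hWfin : volume (⋃ j, W j) ≠ ⊤ := by
      refine ((measure_iUnion_fintype_le _ _).trans_lt (ENNReal.sum_lt_top.2 fun j _ => ?_)).ne
      exact (hWv j).trans_lt ENNReal.ofReal_lt_top
    have hdiff : volume.real Ω - ∑ j, Real.pi * t j ^ 2 ≤ volume.real (Ω \ ⋃ j, W j) :=
      (sub_le_sub_left hWreal _).trans (le_measureReal_sdiff hWfin)
    have hint : IntegrableOn (fun x => ‖gaugedCutoff U (finMin f) θ x‖ ^ 2) Ω :=
      hH1.memLp.integrable_norm_pow two_ne_zero
    refine hdiff.trans ((?_ : _ ≤ ∫ x in Ω \ ⋃ j, W j, ‖gaugedCutoff U (finMin f) θ x‖ ^ 2).trans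
      (setIntegral_mono_set hint (.of_forall fun x => by positivity)
        sdiff_subset.eventuallyLE))
    have hone : ∀ x ∈ Ω \ ⋃ j, W j, ‖gaugedCutoff U (finMin f) θ x‖ ^ 2 = 1 := by
      rintro x ⟨hxΩ, hxW⟩
      have hx1 : finMin f x = 1 := by
        obtain ⟨j, hj⟩ := exists_finMin_eq (f := f) x
        rw [hj]
        exact segmentCutoff_eq_one (hs0 j) (hst j) (not_lt.1 fun h => hxW (mem_iUnion.2 ⟨j, h⟩))
      have hxU : x ∈ U := hsupp ⟨hxΩ, subset_tsupport _ (by simp [hx1])⟩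
      rw [gaugedCutoff, indicator_of_mem hxU, norm_mul, Complex.norm_exp_ofReal_mul_I, hx1]
      simp
    rw [setIntegral_congr_fun (hΩ.measurableSet.diff hWm) hone]
    simp

/-! ### Choice of the radii and comparison with the mean length -/

/-- The endpoint `H = 0` is included: the conventions `log 0 = 0` and `0⁻¹ = 0` agree with the limit
of `1 / log x` at `0⁺`. -/
theorem continuousWithinAt_inv_log {H : ℝ} (h0 : 0 ≤ H) (h1 : H < 1) :
    ContinuousWithinAt (fun x => (Real.log x)⁻¹) (Ioi H) H := by
  rcases h0.eq_or_lt with rfl | h0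
  · rw [ContinuousWithinAt, Real.log_zero, inv_zero]
    exact Real.tendsto_log_nhdsGT_zero.inv_tendsto_atBot
  · exact ((Real.continuousAt_log h0.ne').inv₀ (Real.log_neg h0 h1).ne).continuousWithinAt

/-- The radii need `s j > dist / π` strictly, also for segments reduced to points, so every length
is enlarged by `y - H > 0` and `y` tends to `H` from the right. -/
theorem groundEnergy_le_of_cut {ι : Type*} [Fintype ι] [Nonempty ι] {Ω : Set Plane}
    {A : Plane → (Plane →L[ℝ] ℝ)} (hΩ : IsOpen Ω) (hΩb : Bornology.IsBounded Ω)
    (hΩ0 : Ω.Nonempty) (hA : IsClosedPotential Ω A) (Γ : ι → Plane × Plane)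
    (hsc : IsSimplyConnected (Ω \ ⋃ j, segment ℝ (Γ j).1 (Γ j).2)) {H : ℝ}
    (hH : ∀ j, dist (Γ j).1 (Γ j).2 ≤ H) (hH1 : H < 1)
    (harea : ∑ j, dist (Γ j).1 (Γ j).2 ≤ volume.real Ω / (2 * Real.pi)) :
    groundEnergy Ω A ≤ 8 * Real.pi * Fintype.card ι / volume.real Ω * -(Real.log H)⁻¹ := by
  have hπ := Real.pi_gt_three
  have hvol : 0 < volume.real Ω :=
    ENNReal.toReal_pos (hΩ.measure_pos volume hΩ0).ne' hΩb.measure_lt_top.ne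
  have hH0 : 0 ≤ H := dist_nonneg.trans (hH (Classical.arbitrary ι))
  have hlim := ((continuousWithinAt_inv_log hH0 hH1).neg.const_mul
    (8 * Real.pi * Fintype.card ι / volume.real Ω)).tendsto
  have hn : 0 < (Fintype.card ι : ℝ) := by exact_mod_cast Fintype.card_pos
  refine ge_of_tendsto hlim ?_
  have hδ : 0 < volume.real Ω / Fintype.card ι := by positivity
  filter_upwards [Ioo_mem_nhdsGT (show H < min 1 (H + volume.real Ω / Fintype.card ι) from
    lt_min hH1 (by linarith))] with y hy
  have hHy : H < y := hy.1
  have hy1 : y < 1 := hy.2.trans_le (min_le_left _ _)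
  have hyδ : y - H < volume.real Ω / Fintype.card ι := by
    linarith [hy.2.trans_le (min_le_right 1 (H + volume.real Ω / Fintype.card ι))]
  let η : ι → ℝ := fun j => dist (Γ j).1 (Γ j).2 + (y - H)
  have hη0 : ∀ j, 0 < η j := fun j =>
    add_pos_of_nonneg_of_pos dist_nonneg (by linarith)
  have hηy : ∀ j, η j ≤ y := fun j => by simp only [η]; linarith [hH j]
  have hη1 : ∀ j, η j < 1 := fun j => (hηy j).trans_lt hy1
  have hsq : ∀ j, Real.pi * (√(η j) / Real.pi) ^ 2 = η j / Real.pi := fun j => by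
    rw [div_pow, Real.sq_sqrt (hη0 j).le]; field_simp
  have hlog : ∀ j, Real.log (√(η j) / Real.pi / (η j / Real.pi)) = -Real.log (η j) / 2 := by
    intro j
    have := hη0 j
    rw [div_div_div_cancel_right₀ Real.pi_ne_zero, Real.log_div (by positivity) this.ne',
      Real.log_sqrt this.le]
    ring
  have hηsum : ∑ j, Real.pi * (√(η j) / Real.pi) ^ 2 ≤ volume.real Ω / 2 := by
    have h1 : ∑ j, η j ≤ volume.real Ω / (2 * Real.pi) + volume.real Ω := by
      simp only [η, Finset.sum_add_distrib, Finset.sum_const, Finset.card_univ, nsmul_eq_mul]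
      refine add_le_add harea ?_
      rw [mul_comm]
      exact ((lt_div_iff₀ hn).1 hyδ).le
    simp_rw [hsq]
    rw [← Finset.sum_div, div_le_iff₀ Real.pi_pos]
    -- Since `π > 3`, the enlarged lengths sum to at most `7|Ω|/6 ≤ π|Ω|/2`.
    have h2 : volume.real Ω / (2 * Real.pi) ≤ volume.real Ω / 6 :=
      div_le_div_of_nonneg_left hvol.le (by norm_num) (by linarith)
    nlinarith
  have hmain := groundEnergy_le_of_isSimplyConnected hΩ hΩb hA Γ hsc
    (s := fun j => η j / Real.pi) (t := fun j => √(η j) / Real.pi)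
    (fun j => div_lt_div_of_pos_right (by simp only [η]; linarith) Real.pi_pos)
    -- `s j < t j` amounts to `η < √η`, which holds as `0 < η < 1`.
    (fun j => div_lt_div_of_pos_right (by
      rw [Real.lt_sqrt (hη0 j).le]
      nlinarith [hη0 j, hη1 j]) Real.pi_pos)
    (by linarith)
  have hy0 : 0 < y := by linarith
  have hly : 0 < -Real.log y := neg_pos.2 (Real.log_neg hy0 hy1)
  have hnum : ∑ j, 2 * Real.pi / Real.log (√(η j) / Real.pi / (η j / Real.pi)) ≤
      Fintype.card ι * (4 * Real.pi / -Real.log y) := by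
    have : ∀ j ∈ Finset.univ, 2 * Real.pi / Real.log (√(η j) / Real.pi / (η j / Real.pi)) ≤
        4 * Real.pi / -Real.log y := fun j _ => by
      rw [hlog, div_div_eq_mul_div, show 2 * Real.pi * 2 = 4 * Real.pi by ring]
      exact div_le_div_of_nonneg_left (by positivity) hly
        (neg_le_neg (Real.log_le_log (hη0 j) (hηy j)))
    simpa using Finset.sum_le_card_nsmul _ _ _ this
  refine hmain.trans ((div_le_div₀ (by positivity) hnum (by positivity)
    (show volume.real Ω / 2 ≤ _ by linarith)).trans_eq ?_)
  simp only [Pi.neg_apply]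
  rw [← inv_neg]
  field_simp
  ring

/-- Since `h ≥ H` and `log n ≤ n - 1`, one has `-log (h/n) ≤ -log H + (n - 1)`, and `-log H ≥ 1`
absorbs the last term into `n · (-log H)`. -/
theorem neg_inv_log_le {n : ℕ} (hn : 1 ≤ n) {H h : ℝ} (hH0 : 0 ≤ H) (hH : H ≤ Real.exp (-2))
    (hHh : H ≤ h) (hhn : h ≤ n * H) : -(Real.log H)⁻¹ ≤ n * (1 / |Real.log (h / n)|) := by
  have hn' : (1 : ℝ) ≤ n := by exact_mod_cast hn
  rcases hH0.eq_or_lt with rfl | hH0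
  -- If `H = 0`, the left side is zero by the convention `log 0 = 0`.
  · simp; positivity
  have h0 : 0 < h := hH0.trans_le hHh
  have hlH : Real.log H ≤ -2 := by
    rw [← Real.log_exp (-2)]; exact Real.log_le_log hH0 hH
  have hle : Real.log (h / n) ≤ Real.log H :=
    Real.log_le_log (by positivity) ((div_le_iff₀ (by positivity)).2 (by linarith))
  have hlog : -Real.log (h / n) ≤ n * -Real.log H := by
    rw [Real.log_div h0.ne' (by positivity)]
    have h1 := Real.log_le_log hH0 hHh
    have h2 := Real.log_le_sub_one_of_pos (show (0 : ℝ) < n by positivity)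
    nlinarith
  rw [abs_of_neg (by linarith), ← inv_neg, mul_one_div, inv_eq_one_div,
    div_le_div_iff₀ (by linarith) (by linarith)]
  linarith

end

theorem corollary2 (Ω : Set Plane) (hΩ : IsSmoothBoundedDomain Ω) (hn : 1 ≤ numHoles Ω)
    (A : Plane → (Plane →L[ℝ] ℝ)) (hA : IsClosedPotential Ω A)
    (Γ : Fin (numHoles Ω) → Plane × Plane) (hΓ : IsAdmissibleCut Ω Γ)
    (hmin : ∑ j, cutLength Γ j = cutConst Ω)
    (harea : cutConst Ω ≤ volume.real Ω / (2 * Real.pi))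
    (hlen : ∀ j, cutLength Γ j ≤ Real.exp (-2)) :
    groundEnergy Ω A ≤
      8 * Real.pi * (numHoles Ω : ℝ) ^ 2 / volume.real Ω *
        (1 / |Real.log (cutConst Ω / (numHoles Ω : ℝ))|) := by
  have : Nonempty (Fin (numHoles Ω)) := ⟨⟨0, hn⟩⟩
  -- The longest segment controls all the cutoffs; its length lies between `h/n` and `h`.
  obtain ⟨j₀, hj₀⟩ := Finite.exists_max (cutLength Γ)
  have h0 : ∀ j, 0 ≤ cutLength Γ j := fun j => dist_nonneg
  have hH1 : cutLength Γ j₀ < 1 := (hlen j₀).trans_lt (Real.exp_lt_one_iff.2 (by norm_num))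
  rw [← hmin] at harea ⊢
  refine (groundEnergy_le_of_cut hΩ.isOpen hΩ.isBounded hΩ.isConnected.nonempty hA Γ
    hΓ.isSimplyConnected hj₀ hH1 harea).trans ?_
  have hbound := neg_inv_log_le hn (h0 j₀) (hlen j₀)
    (Finset.single_le_sum (f := cutLength Γ) (fun j _ => h0 j) (Finset.mem_univ j₀))
    (by simpa using Finset.sum_le_card_nsmul _ _ _ fun j (_ : j ∈ Finset.univ) => hj₀ j)
  rw [Fintype.card_fin]
  refine (mul_le_mul_of_nonneg_left hbound (by positivity)).trans_eq ?_
  ring
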